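/- **Theorem 3.67.** Let $k$ be a complete non-Archimedean valued field (possibly trivially valued); all norms satisfy the strong triangle inequality. *Root data.* A root datum consists of a free $\mathbb Z$-module $\Phi$, $\mathbb Z$-linearly independent simple roots $(\alpha_i)_{i\in I}$ in $\Phi$, a symmetric bilinear form $(\cdot,\cdot):\Phi\times\Phi\to\mathbb Q$ with $(\alpha_i,\alpha_i)\in\{2,4,6,\dots\}$ and $(\alpha_i,\alpha_j)\le 0$ for $i\ne j$, and coroots $\lambda_i\in\mathrm{Hom}_{\mathbb Z}(\Phi,\mathbb Z)$ with $\lambda_i(a)=2(\alpha_i,a)/(\alpha_i,\alpha_i)$ for all $a\in\Phi$. *Completed enveloping algebras.* For $r,s>0$ with $1\le rs$ let $U(\mathfrak g)^{\rm an}_{r,s}$ be the Banach $k$-algebra generated by $F_i,H_i,E_i$ $(i\in I)$ of norms $r,1,s$ subject to $$[H_i,H_j]=0,\quad [H_i,E_j]=(\alpha_i,\alpha_j)E_j,\quad [H_i,F_j]=-(\alpha_i,\alpha_j)F_j,\quad [E_i,F_j]=\delta_{ij}H_i,$$ and, for $i\ne j$ and $N=1-\lambda_i(\alpha_j)$, the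 Serre relations $\sum_{n=0}^{N}(-1)^n\binom Nn v_i^{N-n}v_jv_i^n=0$ for $v=E$ and for $v=F$. That is, it is the quotient, by the closed two-sided ideal generated by these relations, of the completion of the free algebra on these generators for the norm $\|\sum_w c_w w\|=\max_w|c_w|\,r^{\#F(w)}s^{\#E(w)}$, where $w$ runs over words and $\#F(w)$, $\#E(w)$ count the letters $F_i$, $E_i$ in $w$. Let $\mathfrak g_{r,s}\subset U(\mathfrak g)^{\rm an}_{r,s}$ be the closed Lie subalgebra (for the commutator) generated by all $F_i,H_i,E_i$, with the induced norm. Let $\mathfrak g'$, $r'$, $s'$ be a second such choice (another root datum, $r',s'>0$, $1\le r's'$). *Formal power series.* For a Banach space $V$ let $V[[\hbar]]=\prod_{n\ge0}V\hbar^n$, the product being taken in the category of IndBanach spaces over $k$. Explicitly, $V[[\hbar]]$ is the formal colimit, over all sequences $\rho=(\rho_n)$ of positive reals, of the Banach spaces $V_\rho=\{(v_n)_n:\sup_n\|v_n\|/\rho_n<\infty\}$. So a morphism $V[[\hbar]]\to W[[\hbar]]$ is a linear map of spaces of sequences that maps every $V_\rho$ boundedly into some $W_\sigma$. If $V$ is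 a Banach algebra then $V[[\hbar]]$ is an algebra over $k[[\hbar]]$ with the usual multiplication of power series. A *generalised element* of $W[[\hbar]]$ is a morphism $F:k\to W[[\hbar]]$. For generalised elements $F,G$ of $W[[\hbar]]$ with $W$ a Banach algebra, $F*G$ is the generalised element with $(F*G)(1)=F(1)G(1)$; the unit for $*$ is $1\mapsto 1$, and for a map $f$ with values in $W[[\hbar]]$ we write $(F*f*G)(x)=F(1)f(x)G(1)$. *Statement.* Let $$\alpha,\alpha':U(\mathfrak g)^{\rm an}_{r,s}[[\hbar]]\longrightarrow U(\mathfrak g')^{\rm an}_{r',s'}[[\hbar]]$$ be two morphisms of (unital) IndBanach $k[[\hbar]]$-algebras with $\alpha\equiv\alpha'$ modulo $\hbar$, and let $\alpha_0:U(\mathfrak g)^{\rm an}_{r,s}\to U(\mathfrak g')^{\rm an}_{r',s'}$ be their common reduction modulo $\hbar$. Let $\mathfrak g_{r,s}$ act on $M=U(\mathfrak g')^{\rm an}_{r',s'}$ by $x\cdot m=\alpha_0(x)m-m\alpha_0(x)$, and suppose that $H^1_b(\mathfrak g_{r,s},M)=0$; that is, every bounded linear map $f:\mathfrak g_{r,s}\to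 M$ with $f([x,y])=x\cdot f(y)-y\cdot f(x)$ for all $x,y$ is of the form $f(x)=x\cdot m$ for some $m\in M$. Then there is a convolution-invertible generalised element $F:k\to U(\mathfrak g')^{\rm an}_{r',s'}[[\hbar]]$ such that $$\alpha'=F*\alpha*F^{-1}.$$ -/

import Mathlib

open scoped NNReal

noncomputable section

namespace AnalyticRigidity

attribute [local instance] LieRing.ofAssociativeRing

/-! ## Root data -/

/-- Root datum of a (symmetrisable) Kac-Moody Lie algebra.  `Φ` is the weight lattice, `root i` are
the simple roots (a basis of the root lattice, which is the `ℤ`-span of their range), `form` is the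
symmetric bilinear form and `coroot i` are the simple coroots. -/
structure RootDatum (I : Type*) (Φ : Type*) [AddCommGroup Φ] [Module.Free ℤ Φ] where
  root : I → Φ
  root_linearIndependent : LinearIndependent ℤ root
  form : Φ →ₗ[ℤ] Φ →ₗ[ℤ] ℚ
  form_symm : ∀ a b, form a b = form b a
  form_root_self : ∀ i, ∃ n : ℕ, 0 < n ∧ form (root i) (root i) = 2 * n
  form_root_nonpos : ∀ i j, i ≠ j → form (root i) (root j) ≤ 0
  coroot : I → Module.Dual ℤ Φ
  coroot_apply : ∀ i a, (coroot i a : ℚ) = 2 * form (root i) a / form (root i) (root i)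

/-! ## The completed enveloping algebra `U(𝔤)^an_{r,s}` -/

/-- The generators `F i`, `H i`, `E i`. -/
inductive Gen (I : Type*)
  | F : I → Gen I
  | H : I → Gen I
  | E : I → Gen I

/-- The weights of the generators: `r` for `F i`, `1` for `H i`, `s` for `E i`. -/
def Gen.weight {I : Type*} (r s : ℝ≥0) : Gen I → ℝ≥0
  | .F _ => r
  | .H _ => 1
  | .E _ => s

/-- The weight of a word in the generators, the product of the weights of its letters. -/
def wordWeight {I : Type*} (r s : ℝ≥0) : FreeMonoid (Gen I) →* ℝ≥0 :=
  FreeMonoid.lift (Gen.weight r s)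

/-- The free associative unital `k`-algebra on the generators `F i`, `H i`, `E i`. -/
abbrev FreeAlg (k I : Type*) [NormedField k] := MonoidAlgebra k (FreeMonoid (Gen I))

section Free

variable {k : Type*} [NormedField k] {I : Type*}

/-- A generator as an element of the free algebra. -/
def gen (g : Gen I) : FreeAlg k I := MonoidAlgebra.single (FreeMonoid.of g) 1

/-- The Serre expression `∑ₙ (-1)ⁿ (N choose n) x^(N-n) y xⁿ`. -/
def serre {A : Type*} [Ring A] (N : ℕ) (x y : A) : A :=
  ∑ n ∈ Finset.range (N + 1), (-1) ^ n * (N.choose n : A) * (x ^ (N - n) * y * x ^ n)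

variable {Φ : Type*} [AddCommGroup Φ] [Module.Free ℤ Φ]

/-- The elements of the free algebra that are set to zero in the enveloping algebra. For `i ≠ j`
the integer `coroot i (root j)` is nonpositive, so that `1 - coroot i (root j)` is a positive
natural number. The rational numbers `form (root i) (root j)` are integers. -/
inductive Relator (D : RootDatum I Φ) : FreeAlg k I → Prop
  | HH (i j : I) : Relator D (gen (.H i) * gen (.H j) - gen (.H j) * gen (.H i))
  | HE (i j : I) : Relator D (gen (.H i) * gen (.E j) - gen (.E j) * gen (.H i)
      - ((D.form (D.root i) (D.root j) : ℚ) : k) • gen (.E j))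
  | HF (i j : I) : Relator D (gen (.H i) * gen (.F j) - gen (.F j) * gen (.H i)
      + ((D.form (D.root i) (D.root j) : ℚ) : k) • gen (.F j))
  | EF_same (i : I) : Relator D (gen (.E i) * gen (.F i) - gen (.F i) * gen (.E i) - gen (.H i))
  | EF_ne (i j : I) (h : i ≠ j) : Relator D (gen (.E i) * gen (.F j) - gen (.F j) * gen (.E i))
  | serreE (i j : I) (h : i ≠ j) :
      Relator D (serre (1 - D.coroot i (D.root j)).toNat (gen (.E i)) (gen (.E j)))
  | serreF (i j : I) (h : i ≠ j) :
      Relator D (serre (1 - D.coroot i (D.root j)).toNat (gen (.F i)) (gen (.F j)))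

variable (k) in
/-- The two-sided ideal of relations of the enveloping algebra. -/
def relIdeal (D : RootDatum I Φ) : TwoSidedIdeal (FreeAlg k I) :=
  TwoSidedIdeal.span {p | Relator D p}

/-- The weighted Gauss norm on the free algebra, `max_w |p_w| * weight(w)` over all words `w`. -/
def gaussNorm (r s : ℝ≥0) (p : FreeAlg k I) : ℝ≥0 :=
  p.coeff.support.sup fun w => ‖p.coeff w‖₊ * wordWeight r s w

theorem gaussNorm_le_iff (r s : ℝ≥0) (p : FreeAlg k I) (c : ℝ≥0) :
    gaussNorm r s p ≤ c ↔ ∀ w, ‖p.coeff w‖₊ * wordWeight r s w ≤ c := by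
  unfold gaussNorm
  rw [Finset.sup_le_iff]
  refine ⟨fun h w => ?_, fun h w _ => h w⟩
  by_cases hw : p.coeff w = 0
  · simp [hw]
  · exact h w (Finsupp.mem_support_iff.2 hw)

theorem le_gaussNorm (r s : ℝ≥0) (p : FreeAlg k I) (w : FreeMonoid (Gen I)) :
    ‖p.coeff w‖₊ * wordWeight r s w ≤ gaussNorm r s p :=
  (gaussNorm_le_iff r s p _).1 le_rfl w

theorem gaussNorm_zero (r s : ℝ≥0) : gaussNorm r s (0 : FreeAlg k I) = 0 := by
  simp [gaussNorm]

theorem gaussNorm_neg (r s : ℝ≥0) (p : FreeAlg k I) : gaussNorm r s (-p) = gaussNorm r s p := by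
  apply le_antisymm <;> rw [gaussNorm_le_iff] <;> intro w
  · simpa using le_gaussNorm r s p w
  · simpa using le_gaussNorm r s (-p) w

theorem gaussNorm_smul_le (r s : ℝ≥0) (c : k) (p : FreeAlg k I) :
    gaussNorm r s (c • p) ≤ ‖c‖₊ * gaussNorm r s p := by
  rw [gaussNorm_le_iff]
  intro w
  have : (c • p).coeff w = c * p.coeff w := rfl
  rw [this, nnnorm_mul, mul_assoc]
  gcongr
  exact le_gaussNorm r s p w

theorem gaussNorm_single_le (r s : ℝ≥0) (w : FreeMonoid (Gen I)) (c : k) :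
    gaussNorm r s (MonoidAlgebra.single w c) ≤ ‖c‖₊ * wordWeight r s w := by
  classical
  rw [gaussNorm_le_iff]
  intro v
  rw [MonoidAlgebra.coeff_single, Finsupp.single_apply]
  split_ifs with h
  · rw [h]
  · simp

section Ultrametric

variable [IsUltrametricDist k]

theorem gaussNorm_add_le_max (r s : ℝ≥0) (p q : FreeAlg k I) :
    gaussNorm r s (p + q) ≤ max (gaussNorm r s p) (gaussNorm r s q) := by
  rw [gaussNorm_le_iff]
  intro w
  have : (p + q).coeff w = p.coeff w + q.coeff w := rfl
  rw [this]
  have h : ‖p.coeff w + q.coeff w‖₊ ≤ max ‖p.coeff w‖₊ ‖q.coeff w‖₊ :=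
    IsUltrametricDist.norm_add_le_max _ _
  rcases le_max_iff.1 h with h | h
  · exact le_max_of_le_left ((mul_le_mul_left h _).trans (le_gaussNorm r s p w))
  · exact le_max_of_le_right ((mul_le_mul_left h _).trans (le_gaussNorm r s q w))

theorem gaussNorm_add_le (r s : ℝ≥0) (p q : FreeAlg k I) :
    gaussNorm r s (p + q) ≤ gaussNorm r s p + gaussNorm r s q :=
  (gaussNorm_add_le_max r s p q).trans (max_le (by simp) (by simp))

theorem gaussNorm_sum_le {ι : Type*} (r s : ℝ≥0) (t : Finset ι) (f : ι → FreeAlg k I) (c : ℝ≥0)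
    (h : ∀ i ∈ t, gaussNorm r s (f i) ≤ c) : gaussNorm r s (∑ i ∈ t, f i) ≤ c := by
  classical
  induction t using Finset.induction_on with
  | empty => simp [gaussNorm_zero]
  | insert a t ha ih =>
    rw [Finset.sum_insert ha]
    exact (gaussNorm_add_le_max r s _ _).trans (max_le (h a (by simp))
      (ih fun i hi => h i (by simp [hi])))

theorem gaussNorm_mul_le (r s : ℝ≥0) (p q : FreeAlg k I) :
    gaussNorm r s (p * q) ≤ gaussNorm r s p * gaussNorm r s q := by
  have hp : p = ∑ a ∈ p.coeff.support, MonoidAlgebra.single a (p.coeff a) :=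
    (MonoidAlgebra.sum_coeff_single p).symm
  have hq : q = ∑ a ∈ q.coeff.support, MonoidAlgebra.single a (q.coeff a) :=
    (MonoidAlgebra.sum_coeff_single q).symm
  have hpq : p * q = ∑ a ∈ p.coeff.support, ∑ b ∈ q.coeff.support,
      MonoidAlgebra.single (a * b) (p.coeff a * q.coeff b) := by
    conv_lhs => rw [hp, hq, Finset.sum_mul_sum]
    simp only [MonoidAlgebra.single_mul_single]
  rw [hpq]
  refine gaussNorm_sum_le r s _ _ _ fun a _ => gaussNorm_sum_le r s _ _ _ fun b _ => ?_
  refine (gaussNorm_single_le r s _ _).trans ?_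
  rw [nnnorm_mul, map_mul, mul_mul_mul_comm]
  exact mul_le_mul' (le_gaussNorm r s p a) (le_gaussNorm r s q b)

end Ultrametric

/-- The quotient seminorm of the Gauss norm by the ideal of relations, as a function on the free
algebra: the infimum of the Gauss norms of the elements congruent to `p` modulo the relations. -/
def quotNorm (D : RootDatum I Φ) (r s : ℝ≥0) (p : FreeAlg k I) : ℝ≥0 :=
  ⨅ j : relIdeal k D, gaussNorm r s (p + (j : FreeAlg k I))

theorem quotNorm_le (D : RootDatum I Φ) (r s : ℝ≥0) (p : FreeAlg k I) {j : FreeAlg k I}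
    (hj : j ∈ relIdeal k D) : quotNorm D r s p ≤ gaussNorm r s (p + j) :=
  ciInf_le (OrderBot.bddBelow _) (⟨j, hj⟩ : relIdeal k D)

theorem quotNorm_le_gaussNorm (D : RootDatum I Φ) (r s : ℝ≥0) (p : FreeAlg k I) :
    quotNorm D r s p ≤ gaussNorm r s p := by
  simpa using quotNorm_le D r s p (relIdeal k D).zero_mem

theorem quotNorm_neg_le (D : RootDatum I Φ) (r s : ℝ≥0) (p : FreeAlg k I) :
    quotNorm D r s (-p) ≤ quotNorm D r s p := by
  refine le_ciInf fun j => ?_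
  refine (quotNorm_le D r s (-p) ((relIdeal k D).neg_mem j.2)).trans ?_
  rw [← neg_add, gaussNorm_neg]

/-- The quotient seminorm, as a ring seminorm on the free algebra. -/
def quotSeminorm [IsUltrametricDist k] (D : RootDatum I Φ) (r s : ℝ≥0) : RingSeminorm (FreeAlg k I) where
  toFun p := quotNorm D r s p
  map_zero' := by
    have h := quotNorm_le_gaussNorm D r s (0 : FreeAlg k I)
    rw [gaussNorm_zero] at h
    simpa using h
  add_le' p q := by
    rw [← NNReal.coe_add, NNReal.coe_le_coe]
    refine NNReal.le_iInf_add_iInf fun i j => ?_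
    refine (quotNorm_le D r s (p + q) ((relIdeal k D).add_mem i.2 j.2)).trans ?_
    rw [add_add_add_comm]
    exact gaussNorm_add_le r s _ _
  neg' p := by
    rw [NNReal.coe_inj]
    refine le_antisymm (quotNorm_neg_le D r s p) ?_
    simpa using quotNorm_neg_le D r s (-p)
  mul_le' p q := by
    rw [← NNReal.coe_mul, NNReal.coe_le_coe]
    refine NNReal.le_iInf_mul_iInf fun i j => ?_
    have hmem : p * (j : FreeAlg k I) + (i : FreeAlg k I) * (q + j) ∈ relIdeal k D :=
      (relIdeal k D).add_mem ((relIdeal k D).mul_mem_left _ _ j.2)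
        ((relIdeal k D).mul_mem_right _ _ i.2)
    refine (quotNorm_le D r s (p * q) hmem).trans ?_
    rw [show p * q + (p * (j : FreeAlg k I) + (i : FreeAlg k I) * (q + j))
      = (p + i) * (q + j) by noncomm_ring]
    exact gaussNorm_mul_le r s _ _

end Free

/-- The free algebra, equipped with the quotient seminorm pulled back from the algebraic enveloping
algebra (all relations have seminorm zero, so they vanish in the separated completion). -/
@[nolint unusedArguments]
def SeminormedEnv (k : Type*) [NormedField k] [IsUltrametricDist k] {I Φ : Type*} [AddCommGroup Φ]
    [Module.Free ℤ Φ] (_D : RootDatum I Φ) (_r _s : ℝ≥0) : Type _ :=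
  FreeAlg k I

section Env

variable (k : Type*) [NormedField k] [IsUltrametricDist k] {I Φ : Type*} [AddCommGroup Φ]
  [Module.Free ℤ Φ] (D : RootDatum I Φ) (r s : ℝ≥0)

instance : SeminormedRing (SeminormedEnv k D r s) :=
  RingSeminorm.toSeminormedRing (R := FreeAlg k I) (quotSeminorm D r s)

instance : NormedAlgebra k (SeminormedEnv k D r s) where
  toAlgebra := inferInstanceAs (Algebra k (FreeAlg k I))
  norm_smul_le c p := by
    change (quotNorm D r s (c • (show FreeAlg k I from p)) : ℝ)
      ≤ ‖c‖ * (quotNorm D r s (show FreeAlg k I from p) : ℝ)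
    rw [← coe_nnnorm, ← NNReal.coe_mul, NNReal.coe_le_coe, quotNorm, quotNorm, NNReal.mul_iInf]
    refine le_ciInf fun j => ?_
    have hmem : c • (j : FreeAlg k I) ∈ relIdeal k D := by
      rw [← one_mul (j : FreeAlg k I), ← smul_mul_assoc]
      exact (relIdeal k D).mul_mem_left _ _ j.2
    refine (quotNorm_le D r s _ hmem).trans ?_
    rw [← smul_add]
    exact gaussNorm_smul_le r s _ _

/-- The completed enveloping algebra `U(𝔤)^an_{r,s}`: the Banach algebra with generators
`F i`, `H i`, `E i` of norms `r`, `1`, `s`, subject to the relations of the enveloping algebra. It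
is the separated completion of the enveloping algebra, that is, the quotient of the completed free
algebra by the closed ideal of relations. -/
def AnEnv : Type _ := UniformSpace.Completion (SeminormedEnv k D r s)

instance : NormedRing (AnEnv k D r s) :=
  inferInstanceAs (NormedRing (UniformSpace.Completion (SeminormedEnv k D r s)))

instance : CompleteSpace (AnEnv k D r s) :=
  inferInstanceAs (CompleteSpace (UniformSpace.Completion (SeminormedEnv k D r s)))

instance : NormedAlgebra k (AnEnv k D r s) where
  toAlgebra := inferInstanceAs (Algebra k (UniformSpace.Completion (SeminormedEnv k D r s)))
  norm_smul_le := norm_smul_le (α := k) (β := UniformSpace.Completion (SeminormedEnv k D r s))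

/-- The canonical homomorphism from the free algebra to the completed enveloping algebra. -/
def toAnEnv : FreeAlg k I →ₐ[k] AnEnv k D r s where
  toFun p := UniformSpace.Completion.coe' (α := SeminormedEnv k D r s) p
  map_one' := UniformSpace.Completion.coe_one (SeminormedEnv k D r s)
  map_mul' := UniformSpace.Completion.coe_mul (α := SeminormedEnv k D r s)
  map_zero' := UniformSpace.Completion.coe_zero (α := SeminormedEnv k D r s)
  map_add' := UniformSpace.Completion.coe_add (α := SeminormedEnv k D r s)
  commutes' _ := rfl

/-- The image of a generator in the completed enveloping algebra. -/
def anGen (g : Gen I) : AnEnv k D r s := toAnEnv k D r s (gen g)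

/-- The Banach Lie algebra `𝔤_{r,s}`: the closed Lie subalgebra of the completed enveloping algebra
(with the commutator bracket) generated by all `F i`, `H i`, `E i`; its norm is the restriction of
that of the completed enveloping algebra. -/
def anLie : LieSubalgebra k (AnEnv k D r s) :=
  sInf {L | IsClosed (L : Set (AnEnv k D r s)) ∧ ∀ g : Gen I, anGen k D r s g ∈ L}

end Env

/-! ## Bounded Lie algebra cohomology in degree one -/

section Cohomology

variable {k A : Type*} [NormedField k] [NormedRing A] [NormedAlgebra k A]

/-- A bounded action of a Lie subalgebra `L` of a Banach algebra `A` on a normed space `M`. -/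
structure BoundedRep (L : LieSubalgebra k A) (M : Type*) [NormedAddCommGroup M]
    [NormedSpace k M] where
  action : L →ₗ⁅k⁆ Module.End k M
  bounded : ∃ C : ℝ, ∀ (x : L) (m : M), ‖action x m‖ ≤ C * ‖(x : A)‖ * ‖m‖

variable {L : LieSubalgebra k A} {M : Type*} [NormedAddCommGroup M] [NormedSpace k M]

variable (L M) in
/-- The space of bounded linear maps from `L` to `M`. -/
def boundedMaps : Submodule k (L →ₗ[k] M) where
  carrier := {f | ∃ C : ℝ, ∀ x : L, ‖f x‖ ≤ C * ‖(x : A)‖}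
  zero_mem' := ⟨0, fun x => by simp⟩
  add_mem' := by
    rintro f g ⟨C, hC⟩ ⟨C', hC'⟩
    refine ⟨C + C', fun x => (norm_add_le _ _).trans ?_⟩
    rw [add_mul]
    exact add_le_add (hC x) (hC' x)
  smul_mem' := by
    rintro c f ⟨C, hC⟩
    refine ⟨‖c‖ * C, fun x => (norm_smul_le _ _).trans ?_⟩
    rw [mul_assoc]
    exact mul_le_mul_of_nonneg_left (hC x) (norm_nonneg c)

variable (L M) in
/-- Bounded 1-cochains: the bounded linear maps from `L` to `M`. -/
def Cochain1 : Type _ := boundedMaps L M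

instance : AddCommGroup (Cochain1 L M) := inferInstanceAs (AddCommGroup (boundedMaps L M))

instance : Module k (Cochain1 L M) := inferInstanceAs (Module k (boundedMaps L M))

/-- The linear map underlying a bounded 1-cochain. -/
def Cochain1.toLin : Cochain1 L M →ₗ[k] (L →ₗ[k] M) := (boundedMaps L M).subtype

/-- The differential from 0-cochains to 1-cochains, `(δ₀ m) x = x · m`. -/
def delta0 (ρ : BoundedRep L M) : M →ₗ[k] Cochain1 L M :=
  LinearMap.codRestrict (boundedMaps L M) (LinearMap.flip (ρ.action : L →ₗ[k] Module.End k M))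
    fun m => by
      obtain ⟨C, hC⟩ := ρ.bounded
      exact ⟨C * ‖m‖, fun x => (hC x m).trans (le_of_eq (by ring))⟩

/-- The differential on 1-cochains, `(δ₁ f)(x, y) = x · f y - y · f x - f [x, y]`, with values in
the space of bilinear maps (they are bounded and alternating, but this is not needed for the
kernel). -/
def delta1 (ρ : BoundedRep L M) : Cochain1 L M →ₗ[k] (L →ₗ[k] L →ₗ[k] M) where
  toFun f := LinearMap.mk₂ k
    (fun x y => ρ.action x (f.toLin y) - ρ.action y (f.toLin x) - f.toLin ⁅x, y⁆)
    (fun x x' y => by simp; abel)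
    (fun c x y => by simp [smul_sub])
    (fun x y y' => by simp; abel)
    (fun c x y => by simp [smul_sub])
  map_add' f g := by ext x y; simp; abel
  map_smul' c f := by ext x y; simp [smul_sub]

/-- The first bounded cohomology `H¹_b(L, M) = Ker δ₁ / Im δ₀` (as a vector space). -/
abbrev H1b (ρ : BoundedRep L M) : Type _ :=
  LinearMap.ker (delta1 ρ) ⧸ (LinearMap.range (delta0 ρ)).submoduleOf (LinearMap.ker (delta1 ρ))

end Cohomology

/-! ## Formal power series in `ħ` and their morphisms in `IndBan`

For a Banach space `V` the product `V⟦ħ⟧ = ∏ₙ V ħⁿ` in `IndBan` is the formal filtered colimit, over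
all sequences `ρ` of positive reals, of the Banach spaces
`V_ρ = {(vₙ) | supₙ ‖vₙ‖ / ρₙ < ∞}` with norm `supₙ ‖vₙ‖ / ρₙ`. The transition maps are injective and
the union of the `V_ρ` is the space of all sequences. So a morphism `V⟦ħ⟧ → W⟦ħ⟧` in `IndBan` is a
linear map between the spaces of sequences which maps every `V_ρ` boundedly to some `W_σ`. -/

section Formal

open PowerSeries

/-- The boundedness condition that characterises the morphisms `V⟦ħ⟧ → W⟦ħ⟧` of `IndBan` among the
linear maps: for every `ρ` there is `σ` such that `f` maps `V_ρ` to `W_σ` with norm at most `1`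
(a larger bound can be absorbed in `σ`). -/
def IndBounded {V W : Type*} [NormedRing V] [NormedRing W] (f : V⟦X⟧ → W⟦X⟧) : Prop :=
  ∀ ρ : ℕ → ℝ, (∀ n, 0 < ρ n) → ∃ σ : ℕ → ℝ, (∀ n, 0 < σ n) ∧
    ∀ (x : V⟦X⟧) (c : ℝ), (∀ n, ‖coeff n x‖ ≤ c * ρ n) → ∀ n, ‖coeff n (f x)‖ ≤ c * σ n

variable (k A B : Type*) [NormedField k] [NormedRing A] [NormedAlgebra k A] [NormedRing B]
  [NormedAlgebra k B]

/-- A morphism of `k⟦ħ⟧`-algebras `A⟦ħ⟧ → B⟦ħ⟧` in `IndBan` (the formal variable `X` is `ħ`). -/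
structure FormalAlgHom where
  toRingHom : A⟦X⟧ →+* B⟦X⟧
  map_scalar_mul : ∀ (a : k⟦X⟧) (x : A⟦X⟧),
    toRingHom (PowerSeries.map (algebraMap k A) a * x)
      = PowerSeries.map (algebraMap k B) a * toRingHom x
  indBounded : IndBounded toRingHom

variable {k A B}

instance : CoeFun (FormalAlgHom k A B) fun _ => A⟦X⟧ → B⟦X⟧ := ⟨fun α => α.toRingHom⟩

/-- The reduction of `α` modulo `ħ`, an algebra homomorphism `α₀ : A → B`. -/
def FormalAlgHom.reduction (α : FormalAlgHom k A B) : A →ₐ[k] B where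
  toRingHom := (constantCoeff (R := B)).comp (α.toRingHom.comp (C (R := A)))
  commutes' c := by
    have h := α.map_scalar_mul (C c) 1
    simp only [PowerSeries.map_C, map_one, mul_one] at h
    simp [h]

theorem FormalAlgHom.reduction_bounded (α : FormalAlgHom k A B) :
    ∃ K : ℝ, ∀ x : A, ‖α.reduction x‖ ≤ K * ‖x‖ := by
  obtain ⟨σ, -, hσ⟩ := α.indBounded (fun _ => 1) (fun _ => one_pos)
  refine ⟨σ 0, fun x => ?_⟩
  have h := hσ (C x) ‖x‖ (fun n => by
    rw [PowerSeries.coeff_C]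
    split_ifs <;> simp) 0
  rw [PowerSeries.coeff_zero_eq_constantCoeff_apply] at h
  rw [mul_comm]
  exact h

/-- The action of a Lie subalgebra `L` of `A` on `B` through `α` modulo `ħ`:
`x · b = α₀(x) b - b α₀(x)`. -/
def FormalAlgHom.commutatorRep (α : FormalAlgHom k A B) (L : LieSubalgebra k A) :
    BoundedRep L B where
  action := (LieAlgebra.ad k B).comp (α.reduction.toLieHom.comp L.incl)
  bounded := by
    obtain ⟨K, hK⟩ := α.reduction_bounded
    refine ⟨2 * K, fun x m => ?_⟩
    have h : ((LieAlgebra.ad k B).comp (α.reduction.toLieHom.comp L.incl)) x m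
        = α.reduction x * m - m * α.reduction x := rfl
    rw [h]
    calc ‖α.reduction x * m - m * α.reduction x‖
        ≤ ‖α.reduction x * m‖ + ‖m * α.reduction x‖ := norm_sub_le _ _
      _ ≤ ‖α.reduction x‖ * ‖m‖ + ‖m‖ * ‖α.reduction x‖ :=
          add_le_add (norm_mul_le _ _) (norm_mul_le _ _)
      _ = 2 * (‖α.reduction x‖ * ‖m‖) := by ring
      _ ≤ 2 * ((K * ‖(x : A)‖) * ‖m‖) := by gcongr; exact hK x
      _ = 2 * K * ‖(x : A)‖ * ‖m‖ := by ring

variable (k B) in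
/-- A generalised element of `B⟦ħ⟧`: a morphism `k → B⟦ħ⟧` in `IndBan`, that is, a linear map which
factors boundedly through some `B_σ`. -/
structure GeneralisedElement where
  toLinearMap : k →ₗ[k] B⟦X⟧
  bounded : ∃ σ : ℕ → ℝ, (∀ n, 0 < σ n) ∧ ∀ c n, ‖coeff n (toLinearMap c)‖ ≤ ‖c‖ * σ n

namespace GeneralisedElement

variable (k) in
/-- The generalised element `c ↦ c b`. -/
def ofElement (b : B⟦X⟧) : GeneralisedElement k B where
  toLinearMap := LinearMap.toSpanSingleton k _ b
  bounded := by
    refine ⟨fun n => ‖coeff n b‖ + 1, fun n => by positivity, fun c n => ?_⟩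
    have h : coeff n (c • b) = c • coeff n b := rfl
    rw [LinearMap.toSpanSingleton_apply, h]
    refine (norm_smul_le _ _).trans ?_
    gcongr
    simp

/-- The unit for convolution: the unit `k → B⟦ħ⟧` of the algebra. -/
def unit : GeneralisedElement k B := ofElement k 1

/-- The convolution product of generalised elements: the composition
`k ≅ k ⊗ k → B⟦ħ⟧ ⊗ B⟦ħ⟧ → B⟦ħ⟧`. -/
def conv (F G : GeneralisedElement k B) : GeneralisedElement k B :=
  ofElement k (F.toLinearMap 1 * G.toLinearMap 1)

/-- `F * f * G` for generalised elements `F`, `G` of `B⟦ħ⟧` and a map `f : A⟦ħ⟧ → B⟦ħ⟧`: the composition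
`A⟦ħ⟧ ≅ k ⊗ A⟦ħ⟧ ⊗ k → B⟦ħ⟧ ⊗ B⟦ħ⟧ ⊗ B⟦ħ⟧ → B⟦ħ⟧`. -/
def conv₃ (F : GeneralisedElement k B) (f : A⟦X⟧ → B⟦X⟧) (G : GeneralisedElement k B) :
    A⟦X⟧ → B⟦X⟧ :=
  fun x => F.toLinearMap 1 * f x * G.toLinearMap 1

end GeneralisedElement

end Formal

end AnalyticRigidity

end

/-! Write A, B for the two completed enveloping algebras, φ : A → B for the common reduction, β for
α'. It suffices to find a power series F with constant coefficient 1 and β(x) F = F α(x): such an F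
is invertible, and any power series over B is a generalised element, so no growth estimate on its
coefficients is needed.

F is built degree by degree. Its defect a ↦ β(a) F - F α(a) on constants obeys a twisted Leibniz
rule, so if it vanishes below degree n, its coefficient d in degree n is a bounded derivation over
φ. Restricted to the Lie algebra, d is a bounded 1-cocycle, hence d(x) = [φ(x), m] there. Both sides
are continuous φ-derivations and the Lie algebra generates a dense subalgebra, so the equality holds
on all of A. Replacing F by F - m ħⁿ then kills degree n (`exists_defect_coeff_eq_zero`). The
corrections stabilise coefficientwise (`exists_intertwiner`), and ħ-linearity extends the
intertwining from constants to all series (`intertwines_of_defect_eq_zero`). -/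

namespace AnalyticRigidity

attribute [local instance] LieRing.ofAssociativeRing

open PowerSeries

/-! ### Vanishing cohomology in terms of crossed homomorphisms. -/

section Cohomology

variable {k A M : Type*} [NormedField k] [NormedRing A] [NormedAlgebra k A]
  [NormedAddCommGroup M] [NormedSpace k M] {L : LieSubalgebra k A}

/-- If `H¹_b(L, M) = 0`, every bounded crossed homomorphism `L → M` is principal. -/
theorem exists_action_eq_of_subsingleton_H1b (ρ : BoundedRep L M) (hρ : Subsingleton (H1b ρ))
    (f : L →ₗ[k] M) (hf : ∃ C : ℝ, ∀ x : L, ‖f x‖ ≤ C * ‖(x : A)‖)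
    (hcocycle : ∀ x y : L, f ⁅x, y⁆ = ρ.action x (f y) - ρ.action y (f x)) :
    ∃ m : M, ∀ x : L, f x = ρ.action x m := by
  let c : Cochain1 L M := (⟨f, hf⟩ : boundedMaps L M)
  have hc : c ∈ LinearMap.ker (delta1 ρ) := by
    rw [LinearMap.mem_ker]
    ext x y
    change ρ.action x (f y) - ρ.action y (f x) - f ⁅x, y⁆ = 0
    rw [hcocycle, sub_self]
  have hmem := (Submodule.Quotient.mk_eq_zero _).1
    (Subsingleton.elim (Submodule.Quotient.mk ⟨c, hc⟩ : H1b ρ) 0)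
  obtain ⟨m, hm⟩ := hmem
  refine ⟨m, fun x => ?_⟩
  exact (congrArg (fun e : Cochain1 L M => e.toLin x) hm).symm

end Cohomology

/-! ### Derivations determined by topological generators. -/

section Derivation

variable {k A B : Type*} [NormedField k] [NormedRing A] [NormedAlgebra k A] [NormedRing B]
  [NormedAlgebra k B]

/-- A continuous linear map satisfying the Leibniz rule over an algebra homomorphism vanishes as soon
as it vanishes on a set which generates a dense subalgebra. -/
theorem eq_zero_of_leibniz_of_dense_adjoin (φ : A →ₐ[k] B) (d : A →ₗ[k] B) (hd : Continuous d)
    (hmul : ∀ x y, d (x * y) = φ x * d y + d x * φ y) (S : Set A)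
    (hS : Dense (Algebra.adjoin k S : Set A)) (h : ∀ x ∈ S, d x = 0) : d = 0 := by
  have hone : d 1 = 0 := by simpa using hmul 1 1
  have hadj : ∀ x ∈ Algebra.adjoin k S, d x = 0 := by
    intro x hx
    induction hx using Algebra.adjoin_induction with
    | mem x hx => exact h x hx
    | algebraMap c => rw [Algebra.algebraMap_eq_smul_one, map_smul, hone, smul_zero]
    | add x y _ _ hx hy => rw [map_add, hx, hy, add_zero]
    | mul x y _ _ hx hy => rw [hmul, hx, hy, mul_zero, zero_mul, add_zero]
  have := Continuous.ext_on hS hd continuous_const hadj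
  ext x
  exact congrFun this x

end Derivation

/-! ### Power series, defects and the construction of the intertwiner. -/

section Formal

variable {k A B : Type*} [NormedField k] [NormedRing A] [NormedAlgebra k A] [NormedRing B]
  [NormedAlgebra k B]

/-- Since `X ^ n` is central it can be pulled out of `q`, leaving a product of constant terms. With
its mirror image below, this turns the Leibniz rule for the defect into one for its leading
coefficient. -/
theorem coeff_mul_of_forall_coeff_eq_zero {R : Type*} [Ring R] {n : ℕ} (p q : R⟦X⟧)
    (hq : ∀ i < n, coeff i q = 0) : coeff n (p * q) = constantCoeff p * coeff n q := by
  obtain ⟨q, rfl⟩ := X_pow_dvd_iff.2 hq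
  rw [← mul_assoc, ← X_pow_mul, mul_assoc]
  have h (t : R⟦X⟧) : coeff n (X ^ n * t) = constantCoeff t := by simp [coeff_X_pow_mul']
  simp [h]

theorem coeff_mul_of_forall_coeff_eq_zero' {R : Type*} [Ring R] {n : ℕ} (p q : R⟦X⟧)
    (hp : ∀ i < n, coeff i p = 0) : coeff n (p * q) = coeff n p * constantCoeff q := by
  obtain ⟨p, rfl⟩ := X_pow_dvd_iff.2 hp
  have h (t : R⟦X⟧) : coeff n (X ^ n * t) = constantCoeff t := by simp [coeff_X_pow_mul']
  simp [mul_assoc, h]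

/-- A map from a normed group to formal power series each of whose coefficients is bounded. -/
def CoeffBounded (g : A → B⟦X⟧) : Prop :=
  ∀ n, ∃ K : ℝ, ∀ a, ‖coeff n (g a)‖ ≤ K * ‖a‖

theorem CoeffBounded.sub {g h : A → B⟦X⟧} (hg : CoeffBounded g) (hh : CoeffBounded h) :
    CoeffBounded fun a => g a - h a := by
  intro n
  obtain ⟨K, hK⟩ := hg n
  obtain ⟨K', hK'⟩ := hh n
  refine ⟨K + K', fun a => ?_⟩
  rw [map_sub, add_mul]
  exact (norm_sub_le _ _).trans (add_le_add (hK a) (hK' a))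

theorem CoeffBounded.mul_const {g : A → B⟦X⟧} (hg : CoeffBounded g) (F : B⟦X⟧) :
    CoeffBounded fun a => g a * F := by
  intro n
  choose K hK using hg
  refine ⟨∑ p ∈ Finset.HasAntidiagonal.antidiagonal n, K p.1 * ‖coeff p.2 F‖, fun a => ?_⟩
  rw [coeff_mul, Finset.sum_mul]
  refine norm_sum_le_of_le _ fun p _ => (norm_mul_le _ _).trans ?_
  rw [mul_right_comm]
  exact mul_le_mul_of_nonneg_right (hK _ a) (norm_nonneg _)

theorem CoeffBounded.const_mul {g : A → B⟦X⟧} (hg : CoeffBounded g) (F : B⟦X⟧) :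
    CoeffBounded fun a => F * g a := by
  intro n
  choose K hK using hg
  refine ⟨∑ p ∈ Finset.HasAntidiagonal.antidiagonal n, ‖coeff p.1 F‖ * K p.2, fun a => ?_⟩
  rw [coeff_mul, Finset.sum_mul]
  refine norm_sum_le_of_le _ fun p _ => (norm_mul_le _ _).trans ?_
  rw [mul_assoc]
  exact mul_le_mul_of_nonneg_left (hK _ a) (norm_nonneg _)

namespace FormalAlgHom

theorem coeffBounded (α : FormalAlgHom k A B) : CoeffBounded fun a => α (C a) := by
  intro n
  -- The series `C a` lies in the space `V_ρ` for `ρ = 1`, with norm at most `‖a‖`; the resulting `σ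
  -- n` bounds the coefficient in degree `n`.
  obtain ⟨σ, -, hσ⟩ := α.indBounded (fun _ => 1) (fun _ => one_pos)
  refine ⟨σ n, fun a => ?_⟩
  rw [mul_comm]
  refine hσ (C a) ‖a‖ (fun i => ?_) n
  rw [coeff_C]
  split_ifs <;> simp

theorem map_X_mul (α : FormalAlgHom k A B) (x : A⟦X⟧) : α (X * x) = X * α x := by
  simpa using α.map_scalar_mul X x

theorem map_C_smul (α : FormalAlgHom k A B) (c : k) (a : A) : α (C (c • a)) = c • α (C a) := by
  have h := α.map_scalar_mul (C c) (C a)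
  simp only [map_C, ← map_mul, ← Algebra.smul_def] at h
  rw [h]
  ext n
  rw [coeff_C_mul, ← Algebra.smul_def]
  rfl

/-- The failure of `F` to intertwine `α` and `β` on constants, `a ↦ β(a) F - F α(a)`. -/
noncomputable def defect (α β : FormalAlgHom k A B) (F : B⟦X⟧) : A →ₗ[k] B⟦X⟧ where
  toFun a := β (C a) * F - F * α (C a)
  map_add' a b := by simp only [map_add]; noncomm_ring
  map_smul' c a := by
    simp only [map_C_smul, smul_mul_assoc, mul_smul_comm, smul_sub, RingHom.id_apply]

theorem defect_apply (α β : FormalAlgHom k A B) (F : B⟦X⟧) (a : A) :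
    defect α β F a = β (C a) * F - F * α (C a) := rfl

/-- Insert and subtract `β (C a) * F * α (C b)`. -/
theorem defect_mul (α β : FormalAlgHom k A B) (F : B⟦X⟧) (a b : A) :
    defect α β F (a * b) = β (C a) * defect α β F b + defect α β F a * α (C b) := by
  simp only [defect_apply, map_mul]
  noncomm_ring

theorem defect_add (α β : FormalAlgHom k A B) (F G : B⟦X⟧) (a : A) :
    defect α β (F + G) a = defect α β F a + defect α β G a := by
  simp only [defect_apply]
  noncomm_ring

/-- A power series which intertwines `α` and `β` on constants intertwines them. -/
theorem intertwines_of_defect_eq_zero (α β : FormalAlgHom k A B) (F : B⟦X⟧)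
    (h : ∀ a, defect α β F a = 0) (x : A⟦X⟧) : β x * F = F * α x := by
  -- Induction on the degree, for all `x` at once: split off the constant term, which the defect
  -- hypothesis handles; the rest is a multiple of `X`, and pulling `X` out lowers the degree. No
  -- ħ-adic continuity of `α` or `β` is required.
  have key : ∀ (n : ℕ) (x : A⟦X⟧), coeff n (β x * F) = coeff n (F * α x) := by
    intro n
    induction n with
    | zero =>
      intro x
      have hx : x = X * (PowerSeries.mk fun p => coeff (p + 1) x) + C (constantCoeff x) :=
        eq_X_mul_shift_add_const x
      have h0 := congrArg (coeff 0) (h (constantCoeff x))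
      rw [defect_apply, map_sub, map_zero, sub_eq_zero] at h0
      rw [hx, map_add, map_add, map_X_mul, map_X_mul, add_mul, mul_add, map_add, map_add, h0]
      simp
    | succ n ih =>
      intro x
      have hx : x = X * (PowerSeries.mk fun p => coeff (p + 1) x) + C (constantCoeff x) :=
        eq_X_mul_shift_add_const x
      have h0 := congrArg (coeff (n + 1)) (h (constantCoeff x))
      rw [defect_apply, map_sub, map_zero, sub_eq_zero] at h0
      rw [hx, map_add, map_add, map_X_mul, map_X_mul, add_mul, mul_add, map_add, map_add, h0,
        mul_assoc, ← mul_assoc F, ← X_mul, mul_assoc, coeff_succ_X_mul, coeff_succ_X_mul, ih]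
  ext n
  exact key n x

variable {L : LieSubalgebra k A}

/-- The inductive step: an intertwiner modulo `ħⁿ` can be corrected in degree `n` to an intertwiner
modulo `ħⁿ⁺¹`. -/
theorem exists_defect_coeff_eq_zero (α β : FormalAlgHom k A B)
    (hL : Dense (Algebra.adjoin k (L : Set A) : Set A))
    (hH : Subsingleton (H1b (α.commutatorRep L)))
    (hmod : ∀ a, constantCoeff (β (C a)) = constantCoeff (α (C a)))
    {n : ℕ} {F : B⟦X⟧} (hF : ∀ a, ∀ i < n, coeff i (defect α β F a) = 0) :
    ∃ m : B, ∀ a, ∀ i < n + 1, coeff i (defect α β (F + C m * X ^ n) a) = 0 := by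
  let φ := α.reduction
  have hφ (a : A) : constantCoeff (α (C a)) = φ a := rfl
  let d : A →ₗ[k] B :=
    { toFun := fun a => coeff n (defect α β F a)
      map_add' := fun a b => by rw [map_add, map_add]
      map_smul' := fun c a => by rw [map_smul]; rfl }
  have hdb : ∃ K : ℝ, ∀ a, ‖d a‖ ≤ K * ‖a‖ :=
    ((β.coeffBounded.mul_const F).sub (α.coeffBounded.const_mul F)) n
  -- In lowest degree only the reductions of `β` and `α` act, and both equal `φ`.
  have hdmul (a b : A) : d (a * b) = φ a * d b + d a * φ b := by
    change coeff n (defect α β F (a * b)) = _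
    rw [defect_mul, map_add, coeff_mul_of_forall_coeff_eq_zero _ _ (hF b),
      coeff_mul_of_forall_coeff_eq_zero' _ _ (hF a), hmod, hφ, hφ]
    rfl
  have hact (x : L) (b : B) : (α.commutatorRep L).action x b = φ x * b - b * φ x := rfl
  -- Antisymmetrising the Leibniz rule gives the cocycle identity on commutators.
  obtain ⟨m, hm⟩ := exists_action_eq_of_subsingleton_H1b (α.commutatorRep L) hH
    (d ∘ₗ L.toSubmodule.subtype) (hdb.imp fun K hK x => hK x) (fun x y => by
      rw [hact, hact]
      change d ((x : A) * y - y * x) = φ x * d y - d y * φ x - (φ y * d x - d x * φ y)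
      rw [map_sub, hdmul, hdmul]
      abel)
  -- The cohomological hypothesis gives `d = [φ, m]` only on `L`. The difference `e` is again a
  -- φ-derivation, so density propagates its vanishing to `A`.
  let e : A →ₗ[k] B := d - (LinearMap.mulRight k m - LinearMap.mulLeft k m) ∘ₗ φ.toLinearMap
  have he (a : A) : e a = d a - (φ a * m - m * φ a) := rfl
  have hec : Continuous e := by
    obtain ⟨K, hK⟩ := hdb
    obtain ⟨K', hK'⟩ := α.reduction_bounded
    have hd : Continuous d := AddMonoidHomClass.continuous_of_bound d K hK
    have hφc : Continuous φ := AddMonoidHomClass.continuous_of_bound φ K' hK'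
    exact hd.sub ((hφc.mul continuous_const).sub (continuous_const.mul hφc))
  have he0 : e = 0 := by
    refine eq_zero_of_leibniz_of_dense_adjoin φ e hec (fun a b => ?_) L hL fun x hx => ?_
    · simp only [he, hdmul, map_mul]
      noncomm_ring
    · rw [he, sub_eq_zero]
      exact hm ⟨x, hx⟩
  -- The term `C m * X ^ n` would add `φ a * m - m * φ a = d a` to the defect in degree `n`, hence
  -- the sign.
  refine ⟨-m, fun a i hi => ?_⟩
  have hX : defect α β (C (-m) * X ^ n) a = (C m * α (C a) - β (C a) * C m) * X ^ n := by
    rw [defect_apply, mul_assoc, X_pow_mul, map_neg, sub_mul]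
    noncomm_ring
  rw [defect_add, map_add, hX, coeff_mul_X_pow']
  rcases Nat.lt_succ_iff_lt_or_eq.1 hi with hi | rfl
  · rw [hF a i hi, if_neg hi.not_ge, add_zero]
  · have h := he a
    rw [he0, LinearMap.zero_apply] at h
    rw [if_pos le_rfl, Nat.sub_self, coeff_zero_eq_constantCoeff_apply, map_sub, map_mul, map_mul,
      constantCoeff_C, hmod, hφ]
    change d a + _ = 0
    rw [h]
    abel

/-- Homomorphisms with the same reduction modulo `ħ` are intertwined by a power series with constant
coefficient `1`, if the bounded cohomology of a topologically generating Lie subalgebra vanishes. -/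
theorem exists_intertwiner (α β : FormalAlgHom k A B)
    (hL : Dense (Algebra.adjoin k (L : Set A) : Set A))
    (hH : Subsingleton (H1b (α.commutatorRep L)))
    (hmod : ∀ a, constantCoeff (β (C a)) = constantCoeff (α (C a))) :
    ∃ F : B⟦X⟧, constantCoeff F = 1 ∧ ∀ x, β x * F = F * α x := by
  -- The bound `n + 1` makes `P 0 1` the hypothesis that `α` and `β` agree modulo ħ. Corrections
  -- then start in degree 1 and leave the constant coefficient equal to 1.
  let P (n : ℕ) (F : B⟦X⟧) : Prop := ∀ a, ∀ i < n + 1, coeff i (defect α β F a) = 0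
  have h0 : P 0 1 := by
    intro a i hi
    obtain rfl : i = 0 := by omega
    simp [defect_apply, hmod]
  choose m hm using fun (n : ℕ) (F : {F : B⟦X⟧ // P n F}) =>
    exists_defect_coeff_eq_zero α β hL hH hmod F.2
  let G (n : ℕ) : {F : B⟦X⟧ // P n F} :=
    Nat.rec ⟨1, h0⟩ (fun n F => ⟨F.1 + C (m n F) * X ^ (n + 1), hm n F⟩) n
  have hG (n : ℕ) : (G (n + 1)).1 = (G n).1 + C (m n (G n)) * X ^ (n + 1) := rfl
  -- Passing from `G n` to `G (n + 1)` changes only degree `n + 1`, so the diagonal series `F` below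
  -- agrees with `G n` up to degree `n`.
  have hstable : ∀ j n i, i ≤ n → coeff i (G (n + j)).1 = coeff i (G n).1 := by
    intro j
    induction j with
    | zero => intros; rfl
    | succ j ih =>
      intro n i hi
      rw [← add_assoc, hG, map_add, coeff_C_mul_X_pow, if_neg (by omega), add_zero, ih n i hi]
  let F : B⟦X⟧ := PowerSeries.mk fun n => coeff n (G n).1
  have hFG (n i : ℕ) (hi : i ≤ n) : coeff i F = coeff i (G n).1 := by
    obtain ⟨j, rfl⟩ := Nat.exists_eq_add_of_le hi
    rw [hstable j i i le_rfl, coeff_mk]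
  refine ⟨F, ?_, intertwines_of_defect_eq_zero α β F fun a => ?_⟩
  · rw [← coeff_zero_eq_constantCoeff_apply, hFG 0 0 le_rfl]
    simp [G]
  -- The coefficient of the defect in degree `n` involves only the coefficients of `F` up to degree
  -- `n`, so `F` may be replaced by `G n`.
  · ext n
    rw [map_zero, ← (G n).2 a n n.lt_succ_self, defect_apply, defect_apply, map_sub, map_sub,
      coeff_mul, coeff_mul, coeff_mul, coeff_mul]
    congr 1 <;> refine Finset.sum_congr rfl fun p hp => ?_
    · rw [hFG n p.2 (Finset.HasAntidiagonal.antidiagonal.snd_le hp)]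
    · rw [hFG n p.1 (Finset.HasAntidiagonal.antidiagonal.fst_le hp)]

end FormalAlgHom

theorem GeneralisedElement.ofElement_apply_one (b : B⟦X⟧) :
    (GeneralisedElement.ofElement k b).toLinearMap 1 = b :=
  one_smul k b

end Formal

/-! ### Topological generation of the completed enveloping algebra. -/

section Env

variable (k : Type*) [NormedField k] [IsUltrametricDist k] {I Φ : Type*} [AddCommGroup Φ]
  [Module.Free ℤ Φ] (D : RootDatum I Φ) (r s : ℝ≥0)

theorem anGen_mem_anLie (g : Gen I) : anGen k D r s g ∈ anLie k D r s := by
  rw [anLie, ← SetLike.mem_coe, LieSubalgebra.coe_sInf]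
  exact Set.mem_iInter₂.2 fun L hL => hL.2 g

theorem toAnEnv_mem_adjoin (p : FreeAlg k I) :
    toAnEnv k D r s p ∈ Algebra.adjoin k (Set.range (anGen k D r s)) := by
  have hword (w : FreeMonoid (Gen I)) : toAnEnv k D r s (MonoidAlgebra.of k _ w)
      ∈ Algebra.adjoin k (Set.range (anGen k D r s)) := by
    induction w using FreeMonoid.inductionOn' with
    | one => rw [map_one, map_one]; exact one_mem _
    | of_mul g w hw =>
      rw [map_mul, map_mul]
      exact mul_mem (Algebra.subset_adjoin ⟨g, rfl⟩) hw
  induction p using MonoidAlgebra.induction_on with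
  | of w => exact hword w
  | add p q hp hq => rw [map_add]; exact add_mem hp hq
  | smul c p hp => rw [map_smul]; exact Subalgebra.smul_mem _ hp c

/-- The free algebra has dense image in the completion, and this image is generated by the `anGen
g`, which lie in `anLie`. -/
theorem dense_adjoin_anLie :
    Dense (Algebra.adjoin k (anLie k D r s : Set (AnEnv k D r s)) : Set (AnEnv k D r s)) := by
  have hrange : DenseRange (toAnEnv k D r s) :=
    UniformSpace.Completion.denseRange_coe (α := SeminormedEnv k D r s)
  refine Dense.mono ?_ hrange
  rintro _ ⟨p, rfl⟩
  refine Algebra.adjoin_mono ?_ (toAnEnv_mem_adjoin k D r s p)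
  rintro _ ⟨g, rfl⟩
  exact anGen_mem_anLie k D r s g

end Env

end AnalyticRigidity

theorem theorem3p67
    {k : Type*} [NormedField k] [IsUltrametricDist k] [CompleteSpace k]
    {I Φ : Type*} [AddCommGroup Φ] [Module.Free ℤ Φ] (D : AnalyticRigidity.RootDatum I Φ)
    {I' Φ' : Type*} [AddCommGroup Φ'] [Module.Free ℤ Φ'] (D' : AnalyticRigidity.RootDatum I' Φ')
    (r s r' s' : ℝ≥0) (hr : 0 < r) (hs : 0 < s) (hrs : 1 ≤ r * s)
    (hr' : 0 < r') (hs' : 0 < s') (hrs' : 1 ≤ r' * s')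
    (α α' : AnalyticRigidity.FormalAlgHom k (AnalyticRigidity.AnEnv k D r s)
      (AnalyticRigidity.AnEnv k D' r' s'))
    (hmod : ∀ x, (PowerSeries.X : PowerSeries (AnalyticRigidity.AnEnv k D' r' s')) ∣ α' x - α x)
    (hH : Subsingleton (AnalyticRigidity.H1b
      (α.commutatorRep (AnalyticRigidity.anLie k D r s)))) :
    ∃ F Finv : AnalyticRigidity.GeneralisedElement k (AnalyticRigidity.AnEnv k D' r' s'),
      F.conv Finv = AnalyticRigidity.GeneralisedElement.unit ∧
      Finv.conv F = AnalyticRigidity.GeneralisedElement.unit ∧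
      (α' : PowerSeries (AnalyticRigidity.AnEnv k D r s) →
        PowerSeries (AnalyticRigidity.AnEnv k D' r' s')) = F.conv₃ α Finv := by

  obtain ⟨F, hF, hint⟩ := AnalyticRigidity.FormalAlgHom.exists_intertwiner α α'
    (AnalyticRigidity.dense_adjoin_anLie k D r s) hH fun a => by
      have h := PowerSeries.X_dvd_iff.1 (hmod (PowerSeries.C a))
      rwa [map_sub, sub_eq_zero] at h
  -- A constant coefficient 1 makes `F` invertible as a formal series, with a two-sided inverse
  -- although the coefficients do not commute.
  have hmul := PowerSeries.mul_invOfUnit F 1 hF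
  have hmul' := PowerSeries.invOfUnit_mul F 1 hF
  refine ⟨.ofElement k F, .ofElement k (PowerSeries.invOfUnit F 1), ?_, ?_, funext fun x => ?_⟩
  · simp only [AnalyticRigidity.GeneralisedElement.conv,
      AnalyticRigidity.GeneralisedElement.ofElement_apply_one, hmul,
      AnalyticRigidity.GeneralisedElement.unit]
  · simp only [AnalyticRigidity.GeneralisedElement.conv,
      AnalyticRigidity.GeneralisedElement.ofElement_apply_one, hmul',
      AnalyticRigidity.GeneralisedElement.unit]
  · simp only [AnalyticRigidity.GeneralisedElement.conv₃,
      AnalyticRigidity.GeneralisedElement.ofElement_apply_one]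
    rw [← hint, mul_assoc, hmul, mul_one]
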